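/- Let $n\ge 0$, let $\Omega\subset\mathbb{R}^n$ be a smoothly bounded open set, i.e. $\Omega=\{x\in\mathbb{R}^n : r(x)<0\}$ for some $C^\infty$ function $r:\mathbb{R}^n\to\mathbb{R}$ such that $\{r=0\}$ is the topological boundary $b\Omega$ of $\Omega$ and $\nabla r\neq 0$ in a neighborhood of $b\Omega$. Let $p\in b\Omega$, let $U\subset\mathbb{R}^n$ be an open neighborhood of $p$, and let $\sigma:U\to\mathbb{R}$ be a smooth local defining function for $\Omega$ on $U$ (that is, $\sigma\in C^\infty(U)$ and $\Omega\cap U=\{x\in U:\sigma(x)<0\}$) with $\|\nabla\sigma\|=1$ on $b\Omega\cap U$. For a $C^\infty$ function $f$ near $x$ and $\xi,\zeta\in\mathbb{R}^n$ write $H_f(\xi,\zeta)(x)=\sum_{j,k=1}^n\frac{\partial^2 f}{\partial x_j\partial x_k}(x)\,\xi_j\zeta_k$. Suppose that $\Omega$ is convex on $U$: for some smooth local defining function $\rho$ for $\Omega$ on $U$ with $\nabla\rho\ne0$ on $b\Omega\cap U$, one has $H_\rho(\xi,\xi)(x)\ge 0$ for all $x\in b\Omega\cap U$ and all $\xi\in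 T_x(b\Omega)=\{\xi\in\mathbb{R}^n:\langle\nabla\rho(x),\xi\rangle=0\}$ (this condition does not depend on the choice of $\rho$). Then there exist an open neighborhood $V\subset U$ of $p$ and constants $C_1,C_2>0$ such that, for all $x\in V$, $\nabla\sigma(x)\neq0$ and $$H_\sigma(\xi,\xi)(x)\;\ge\;-C_1\,\sigma(x)^2\,\|\xi\|^2-C_2\,\frac{|\langle\nabla\sigma(x),\xi\rangle|^2}{\|\nabla\sigma(x)\|^2}\qquad\text{for all }\xi\in\mathbb{R}^n.$$ -/

import Mathlib

open scoped ContDiff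

noncomputable section

/-- The real Hessian `H_f(ξ, ζ)(x) = ∑ⱼₖ ∂²f/∂xⱼ∂xₖ (x) ξⱼ ζₖ` of `f` at `x`, as the second
Fréchet derivative of `f` applied to `ξ` and `ζ`. -/
def realHessian {n : ℕ} (f : EuclideanSpace ℝ (Fin n) → ℝ) (ξ ζ x : EuclideanSpace ℝ (Fin n)) :
    ℝ :=
  fderiv ℝ (fderiv ℝ f) x ξ ζ

/-- An open set `Ω` with smooth boundary: `Ω = {r < 0}` for some smooth `r` on the whole space, with
`{r = 0} = bΩ` and `∇r ≠ 0` in a neighbourhood of `bΩ`, where `bΩ = frontier Ω`. -/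
def IsSmoothlyBounded {n : ℕ} (Ω : Set (EuclideanSpace ℝ (Fin n))) : Prop :=
  ∃ r : EuclideanSpace ℝ (Fin n) → ℝ,
    ContDiff ℝ ∞ r ∧ Ω = {x | r x < 0} ∧ {x | r x = 0} = frontier Ω ∧
      ∃ N : Set (EuclideanSpace ℝ (Fin n)),
        IsOpen N ∧ frontier Ω ⊆ N ∧ ∀ x ∈ N, gradient r x ≠ 0

/-- `r` is a smooth local defining function for `Ω` on the open set `U`. Only the values of `r`
on `U` matter. -/
def IsSmoothLocalDefiningFunction {n : ℕ} (Ω U : Set (EuclideanSpace ℝ (Fin n)))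
    (r : EuclideanSpace ℝ (Fin n) → ℝ) : Prop :=
  ContDiffOn ℝ ∞ r U ∧ Ω ∩ U = {x ∈ U | r x < 0}

/-- `Ω` is convex on the open set `U`: for some smooth local defining function `r` for `Ω` on `U`
with nonvanishing gradient on `bΩ ∩ U`, the Hessian of `r` at the points `x` of `bΩ ∩ U` is
nonnegative on `T_x(bΩ) = {ξ | ⟨∇r(x), ξ⟩ = 0}`. Neither the condition nor the tangent space
depends on the choice of `r`. -/
def IsConvexDomainOn {n : ℕ} (Ω U : Set (EuclideanSpace ℝ (Fin n))) : Prop :=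
  ∃ r : EuclideanSpace ℝ (Fin n) → ℝ,
    IsSmoothLocalDefiningFunction Ω U r ∧
      (∀ x ∈ frontier Ω ∩ U, gradient r x ≠ 0) ∧
      ∀ x ∈ frontier Ω ∩ U, ∀ ξ : EuclideanSpace ℝ (Fin n),
        inner ℝ (gradient r x) ξ = 0 → 0 ≤ realHessian r ξ ξ x

end

/-! Let `y` be a boundary point nearest to `x`, and `ν = ∇σ(y)`. Then `x - y = tν`, with `|t|`
comparable to `|σ x|`, and the Hessian at `x` is Taylor expanded about `y`. Convexity alone gives
only an error of order `t` on tangent vectors `τ`; the order `t²` comes from `‖∇σ‖ = 1` on the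
boundary. Differentiating this along the boundary gives `H(τ,ν) = 0` and the Riccati identity
`D³σ(ν,τ,τ) = H(ν,ν) H(τ,τ) - ‖Hτ‖²` at `y` (`fderiv_identities_of_norm_gradient_eq_one`).

Since `H ≥ 0` on the tangent space, `‖Hτ‖²` is at most a constant times `H(τ,τ)`
(`norm_sq_le_of_nonneg`). Hence the linear term `t D³σ(ν,τ,τ)` is absorbed by `H(τ,τ)` for small
`t`, and only `O(t²)` is lost. The mixed terms are `O(t)` because `H(τ,ν) = 0` at `y`, so the square
of the normal component and `t²‖τ‖²` control them. `quadratic_lower_bound` combines these estimates.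
-/

open Filter Topology

/-! ### Curves in level sets and Lagrange multipliers to second order. -/

section Calculus

variable {E : Type*} [NormedAddCommGroup E] [NormedSpace ℝ E]

/-- The regular level set `{g = 0}` contains a `C²` curve through each of its points `y` with any
prescribed velocity tangent to it. -/
lemma exists_curve_of_fderiv_eq_zero [CompleteSpace E] {g : E → ℝ} {y v ξ : E}
    (hg : ContDiffAt ℝ 2 g y) (hgy : g y = 0) (hv : fderiv ℝ g y v = 1)
    (hξ : fderiv ℝ g y ξ = 0) :
    ∃ γ : ℝ → E, ContDiffAt ℝ 2 γ 0 ∧ γ 0 = y ∧ HasDerivAt γ ξ 0 ∧ ∀ᶠ s in 𝓝 0, g (γ s) = 0 := by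
  set L := fderiv ℝ g y with hL
  -- `F` has derivative the identity at `y` and satisfies `L (F x - y) = g x`, so its local inverse
  -- carries the affine tangent hyperplane into `{g = 0}`.
  let F : E → E := fun x => x + (g x - L (x - y)) • v
  have hF : ContDiffAt ℝ 2 F y :=
    contDiffAt_id.add ((hg.sub (L.contDiff.contDiffAt.comp y
      (contDiffAt_id.sub contDiffAt_const))).smul contDiffAt_const)
  have hFd : HasFDerivAt F (ContinuousLinearEquiv.refl ℝ E : E →L[ℝ] E) y := by
    have h1 : HasFDerivAt g L y := (hg.differentiableAt two_ne_zero).hasFDerivAt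
    have h2 : HasFDerivAt (fun x => L (x - y)) L y := by
      exact L.hasFDerivAt.comp y ((hasFDerivAt_id y).sub_const y)
    have h3 := (hasFDerivAt_id y).add ((h1.sub h2).smul_const v)
    convert! h3 using 1
    ext z
    simp
  have hFy : F y = y := by simp [F, hgy]
  let G := hF.localInverse hFd two_ne_zero
  have hG : ContDiffAt ℝ 2 G y := by simpa only [hFy] using hF.to_localInverse hFd two_ne_zero
  have hGy : G y = y := by
    have := hF.localInverse_apply_image hFd two_ne_zero
    rwa [hFy] at this
  have hst := hF.hasStrictFDerivAt' hFd two_ne_zero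
  have hGd : HasFDerivAt G (ContinuousLinearMap.id ℝ E) y := by
    have := hst.to_localInverse.hasFDerivAt
    rw [hFy] at this
    exact this
  have hFG : ∀ᶠ z in 𝓝 y, F (G z) = z := by
    have := hst.eventually_right_inverse
    rwa [hFy] at this
  have hgG : ∀ᶠ z in 𝓝 y, g (G z) = L (z - y) := by
    filter_upwards [hFG] with z hz
    have : L (F (G z) - y) = g (G z) := by
      simp only [F, map_sub, map_add, map_smul, hv, smul_eq_mul]
      ring
    rw [← this, hz]
  have hℓ : HasDerivAt (fun s : ℝ => y + s • ξ) ξ 0 := by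
    simpa using ((hasDerivAt_id (0 : ℝ)).smul_const ξ).const_add y
  have hℓ0 : y + (0 : ℝ) • ξ = y := by simp
  refine ⟨fun s => G (y + s • ξ), ?_, by simp [hGy], ?_, ?_⟩
  · refine ContDiffAt.comp (0 : ℝ) (by rw [hℓ0]; exact hG) ?_
    exact contDiffAt_const.add (contDiffAt_id.smul contDiffAt_const)
  · have := HasFDerivAt.comp_hasDerivAt (0 : ℝ) (by rw [hℓ0]; exact hGd) hℓ
    exact this
  · have ht : Tendsto (fun s : ℝ => y + s • ξ) (𝓝 0) (𝓝 y) := by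
      simpa using hℓ.continuousAt.tendsto
    filter_upwards [ht.eventually hgG] with s hs
    simp [hs, hξ]

/-- First and second order conditions for a function vanishing along a curve. -/
lemma fderiv_eq_zero_of_comp_eventually_eq_zero {f : E → ℝ} {γ : ℝ → E} {y ξ : E}
    (hγ : ContDiffAt ℝ 2 γ 0) (hγ0 : γ 0 = y) (hγ1 : HasDerivAt γ ξ 0) (hf : ContDiffAt ℝ 2 f y)
    (h : ∀ᶠ s in 𝓝 (0 : ℝ), f (γ s) = 0) :
    fderiv ℝ f y ξ = 0 ∧
      fderiv ℝ (fderiv ℝ f) y ξ ξ + fderiv ℝ f y (deriv (deriv γ) 0) = 0 := by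
  subst hγ0
  have hfd : ∀ᶠ s in 𝓝 (0 : ℝ), DifferentiableAt ℝ f (γ s) :=
    hγ1.continuousAt.eventually
      ((hf.eventually (by simp)).mono fun x hx => hx.differentiableAt two_ne_zero)
  have hγd : ∀ᶠ s in 𝓝 (0 : ℝ), DifferentiableAt ℝ γ s :=
    (hγ.eventually (by simp)).mono fun x hx => hx.differentiableAt two_ne_zero
  have h1 : ∀ᶠ s in 𝓝 (0 : ℝ), fderiv ℝ f (γ s) (deriv γ s) = 0 := by
    filter_upwards [hfd, hγd, h.eventually_nhds] with s hs hs' hs0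
    have hd := hs.hasFDerivAt.comp_hasDerivAt s hs'.hasDerivAt
    have h0 : HasDerivAt (f ∘ γ) 0 s :=
      (hasDerivAt_const s (0 : ℝ)).congr_of_eventuallyEq hs0
    exact hd.unique h0
  have hγ' : deriv γ 0 = ξ := hγ1.deriv
  refine ⟨by simpa [hγ'] using h1.self_of_nhds, ?_⟩
  have hdf : DifferentiableAt ℝ (fderiv ℝ f) (γ 0) :=
    (hf.fderiv_right (m := 1) (by norm_num)).differentiableAt one_ne_zero
  have hdγ : DifferentiableAt ℝ (deriv γ) 0 := by
    change DifferentiableAt ℝ (fun s => fderiv ℝ γ s 1) 0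
    exact ((hγ.fderiv_right (m := 1) (by norm_num)).differentiableAt one_ne_zero).clm_apply
      (differentiableAt_const _)
  have hd := (hdf.hasFDerivAt.comp_hasDerivAt (0 : ℝ) hγ1).clm_apply hdγ.hasDerivAt
  have h0 : HasDerivAt (fun s => fderiv ℝ f (γ s) (deriv γ s)) 0 0 :=
    (hasDerivAt_const (0 : ℝ) (0 : ℝ)).congr_of_eventuallyEq h1
  simpa [hγ'] using hd.unique h0

/-- A `C²` function vanishing on the regular level set `{g = 0}` near `y` has, up to a Lagrange
multiplier, the same first derivative at `y` and the same second derivative on the tangent space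
as `g`. -/
lemma exists_multiplier_of_eventually_eq_zero [CompleteSpace E] {f g : E → ℝ} {y v : E}
    (hg : ContDiffAt ℝ 2 g y) (hf : ContDiffAt ℝ 2 f y) (hgy : g y = 0)
    (hv : fderiv ℝ g y v = 1) (h : ∀ᶠ x in 𝓝 y, g x = 0 → f x = 0) :
    fderiv ℝ f y = fderiv ℝ f y v • fderiv ℝ g y ∧
      ∀ ξ, fderiv ℝ g y ξ = 0 →
        fderiv ℝ (fderiv ℝ f) y ξ ξ = fderiv ℝ f y v * fderiv ℝ (fderiv ℝ g) y ξ ξ := by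
  -- Here `w` is the acceleration of one curve in `{g = 0}`. It serves both `f` and `g`, so the
  -- multiplier relation eliminates it.
  have key : ∀ ξ, fderiv ℝ g y ξ = 0 → ∃ w,
      fderiv ℝ f y ξ = 0 ∧ fderiv ℝ (fderiv ℝ f) y ξ ξ + fderiv ℝ f y w = 0 ∧
        fderiv ℝ (fderiv ℝ g) y ξ ξ + fderiv ℝ g y w = 0 := by
    intro ξ hξ
    obtain ⟨γ, hγ, hγ0, hγ1, hγg⟩ := exists_curve_of_fderiv_eq_zero hg hgy hv hξ
    have hc : Tendsto γ (𝓝 0) (𝓝 y) := hγ0 ▸ hγ1.continuousAt.tendsto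
    have hγf : ∀ᶠ s in 𝓝 (0 : ℝ), f (γ s) = 0 := by
      filter_upwards [hγg, hc.eventually h] with s hs hs' using hs' hs
    have h1 := fderiv_eq_zero_of_comp_eventually_eq_zero hγ hγ0 hγ1 hf hγf
    exact ⟨_, h1.1, h1.2, (fderiv_eq_zero_of_comp_eventually_eq_zero hγ hγ0 hγ1 hg hγg).2⟩
  have h1 : fderiv ℝ f y = fderiv ℝ f y v • fderiv ℝ g y := by
    ext z
    obtain ⟨w, hw, -⟩ := key (z - fderiv ℝ g y z • v) (by simp [hv])
    simp only [map_sub, map_smul, smul_eq_mul] at hw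
    simp only [_root_.smul_apply, smul_eq_mul]
    linarith
  refine ⟨h1, fun ξ hξ => ?_⟩
  obtain ⟨w, -, hw1, hw2⟩ := key ξ hξ
  have h3 : fderiv ℝ f y w = fderiv ℝ f y v * fderiv ℝ g y w := by
    conv_lhs => rw [h1]
    simp
  linear_combination hw1 - fderiv ℝ f y v * hw2 - h3

/-- A function vanishing at `y` with negative derivative in the direction `v` is negative at the
points `y + s v` with small `s > 0`. -/
lemma eventually_neg_of_fderiv_neg {f : E → ℝ} {y v : E} (hf : DifferentiableAt ℝ f y)
    (hy : f y = 0) (hv : fderiv ℝ f y v < 0) : ∀ᶠ s in 𝓝[>] (0 : ℝ), f (y + s • v) < 0 := by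
  have hℓ : HasDerivAt (fun s : ℝ => y + s • v) v 0 := by
    simpa using ((hasDerivAt_id (0 : ℝ)).smul_const v).const_add y
  have hd : HasDerivAt (fun s : ℝ => f (y + s • v)) (fderiv ℝ f y v) 0 :=
    HasFDerivAt.comp_hasDerivAt (0 : ℝ) (by simpa using hf.hasFDerivAt) hℓ
  have := eventually_nhdsWithin_sign_eq_of_deriv_neg (by rwa [hd.deriv]) (by simpa using hy)
  filter_upwards [nhdsWithin_le_nhds this, self_mem_nhdsWithin] with s hs (hs0 : 0 < s)
  rw [zero_sub, Left.sign_neg, sign_pos hs0] at hs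
  exact sign_eq_neg_one_iff.1 hs

end Calculus

/-- The third derivative of a real function is symmetric. -/
lemma fderiv_fderiv_fderiv_rotate {E : Type*} [NormedAddCommGroup E] [NormedSpace ℝ E]
    {f : E → ℝ} {x : E} (hf : ContDiffAt ℝ 3 f x) (ξ ζ : E) :
    fderiv ℝ (fderiv ℝ (fderiv ℝ f)) x ξ ξ ζ = fderiv ℝ (fderiv ℝ (fderiv ℝ f)) x ζ ξ ξ := by
  have h1 : ContDiffAt ℝ 2 (fderiv ℝ f) x := hf.fderiv_right (by norm_num)
  have h2 : DifferentiableAt ℝ (fderiv ℝ (fderiv ℝ f)) x :=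
    (h1.fderiv_right (m := 1) (by norm_num)).differentiableAt one_ne_zero
  have hd : ∀ a b : E, HasFDerivAt (fun z => fderiv ℝ (fderiv ℝ f) z a b)
      (((fderiv ℝ (fderiv ℝ (fderiv ℝ f)) x).flip a).flip b) x := fun a b => by
    have := (h2.hasFDerivAt.clm_apply (hasFDerivAt_const a x)).clm_apply (hasFDerivAt_const b x)
    convert! this using 1
    ext z
    simp
  have hsymm : ∀ᶠ z in 𝓝 x, fderiv ℝ (fderiv ℝ f) z ξ ζ = fderiv ℝ (fderiv ℝ f) z ζ ξ := by
    filter_upwards [hf.eventually (by simp)] with z hz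
    exact (hz.isSymmSndFDerivAt (by simp; norm_num)).eq ξ ζ
  -- Differentiating the symmetry of the Hessian swaps the last two slots; symmetry of the second
  -- derivative of `fderiv ℝ f` swaps the first two.
  have h3 := congrArg (fun φ : E →L[ℝ] ℝ => φ ξ)
    ((hd ξ ζ).unique ((hd ζ ξ).congr_of_eventuallyEq hsymm))
  simp only [ContinuousLinearMap.flip_apply] at h3
  rw [h3, (h1.isSymmSndFDerivAt (by simp)).eq ξ ζ]

/-! ### The gradient, and identities from its unit length on a level set. -/

section Gradient

variable {E : Type*} [NormedAddCommGroup E] [InnerProductSpace ℝ E] [CompleteSpace E]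

lemma inner_gradient_eq_fderiv (f : E → ℝ) (x ξ : E) : inner ℝ (gradient f x) ξ = fderiv ℝ f x ξ := by
  rw [← InnerProductSpace.toDual_apply_apply (𝕜 := ℝ), toDual_gradient]

/-- The inverse of the Riesz isomorphism, as a linear map over `ℝ`. -/
noncomputable def rieszInverse : StrongDual ℝ E →L[ℝ] E :=
  LinearMap.mkContinuous
    { toFun := (InnerProductSpace.toDual ℝ E).symm
      map_add' := map_add _
      map_smul' := fun c φ => by simp } 1 fun φ => by simp

lemma hasFDerivAt_gradient {f : E → ℝ} {x : E} (hf : ContDiffAt ℝ 2 f x) :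
    ∃ B : E →L[ℝ] E, HasFDerivAt (gradient f) B x ∧
      ∀ ξ ζ, inner ℝ (B ξ) ζ = fderiv ℝ (fderiv ℝ f) x ξ ζ := by
  refine ⟨rieszInverse.comp (fderiv ℝ (fderiv ℝ f) x), ?_, fun ξ ζ => by simp [rieszInverse]⟩
  have hdf : DifferentiableAt ℝ (fderiv ℝ f) x :=
    (hf.fderiv_right (m := 1) (by norm_num)).differentiableAt one_ne_zero
  exact rieszInverse.hasFDerivAt.comp x hdf.hasFDerivAt

lemma contDiffAt_gradient {f : E → ℝ} {x : E} (hf : ContDiffAt ℝ 3 f x) :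
    ContDiffAt ℝ 2 (gradient f) x := by
  exact rieszInverse.contDiff.contDiffAt.comp x (hf.fderiv_right (m := 2) (by norm_num))

/-- Differentiating `‖∇f‖ = 1` twice along the level set `{f = 0}`. -/
lemma fderiv_identities_of_norm_gradient_eq_one {f : E → ℝ} {y : E} (hf : ContDiffAt ℝ 3 f y)
    (hfy : f y = 0) (h : ∀ᶠ x in 𝓝 y, f x = 0 → ‖gradient f x‖ = 1) {τ : E}
    (hτ : fderiv ℝ f y τ = 0) :
    fderiv ℝ (fderiv ℝ f) y τ (gradient f y) = 0 ∧
      ∃ η, (∀ ζ, fderiv ℝ (fderiv ℝ f) y τ ζ = inner ℝ η ζ) ∧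
        fderiv ℝ (fderiv ℝ (fderiv ℝ f)) y (gradient f y) τ τ =
          fderiv ℝ (fderiv ℝ f) y (gradient f y) (gradient f y) * fderiv ℝ (fderiv ℝ f) y τ τ
            - ‖η‖ ^ 2 := by
  have hf2 : ContDiffAt ℝ 2 f y := hf.of_le (by norm_num)
  have hfν : fderiv ℝ f y (gradient f y) = 1 := by
    rw [← inner_gradient_eq_fderiv, real_inner_self_eq_norm_sq, h.self_of_nhds hfy, one_pow]
  -- `k` vanishes on `{f = 0}` and `Dk(ξ) = 2 D²f(ξ, ∇f)`. The first-order multiplier relation gives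
  -- `D²f(τ, ∇f) = 0`; the second-order one, with `D²k(τ,τ)` expanded, gives the Riccati identity.
  let k : E → ℝ := fun x => inner ℝ (gradient f x) (gradient f x) - 1
  have hg := contDiffAt_gradient hf
  have hk : ContDiffAt ℝ 2 k y := (hg.inner ℝ hg).sub contDiffAt_const
  have hk1 : ∀ᶠ x in 𝓝 y, ∀ ξ, fderiv ℝ k x ξ =
      2 * fderiv ℝ (fderiv ℝ f) x ξ (gradient f x) := by
    filter_upwards [hf2.eventually (by simp)] with x hx ξ
    obtain ⟨B, hB, hB'⟩ := hasFDerivAt_gradient hx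
    have := ((hB.inner ℝ hB).sub_const 1).fderiv
    have h2 : fderiv ℝ k x ξ = _ := congrArg (fun φ : E →L[ℝ] ℝ => φ ξ) this
    rw [h2, ← hB']
    simp [fderivInnerCLM_apply]
    ring
  obtain ⟨hm1, hm2⟩ := exists_multiplier_of_eventually_eq_zero hf2 hk hfy hfν
    (h.mono fun x hx hx0 => by simp [k, hx hx0])
  have hkν := hk1.self_of_nhds
  have hτν : fderiv ℝ (fderiv ℝ f) y τ (gradient f y) = 0 := by
    have h1 := hkν τ
    rw [hm1] at h1
    simp only [_root_.smul_apply, hτ, smul_zero] at h1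
    linarith
  obtain ⟨B, hB, hB'⟩ := hasFDerivAt_gradient hf2
  refine ⟨hτν, B τ, fun ζ => (hB' τ ζ).symm, ?_⟩
  have h2 : DifferentiableAt ℝ (fderiv ℝ (fderiv ℝ f)) y :=
    ((hf.fderiv_right (m := 2) (by norm_num)).fderiv_right
      (m := 1) (by norm_num)).differentiableAt one_ne_zero
  have hdk : DifferentiableAt ℝ (fderiv ℝ k) y :=
    (hk.fderiv_right (m := 1) (by norm_num)).differentiableAt one_ne_zero
  have e1 := (hdk.hasFDerivAt.clm_apply (hasFDerivAt_const τ y))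
  have e2 := ((h2.hasFDerivAt.clm_apply (hasFDerivAt_const τ y)).clm_apply hB).const_mul 2
  have e3 := congrArg (fun φ : E →L[ℝ] ℝ => φ τ)
    (e1.unique (e2.congr_of_eventuallyEq (hk1.mono fun x hx => hx τ)))
  have e4 : fderiv ℝ (fderiv ℝ f) y τ (B τ) = ‖B τ‖ ^ 2 := by
    rw [← hB', real_inner_self_eq_norm_sq]
  simp at e3
  rw [hm2 τ hτ, hkν, fderiv_fderiv_fderiv_rotate hf, e4] at e3
  linarith

end Gradient

/-! ### Local defining functions and independence of convexity from their choice. -/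

section Domain

variable {n : ℕ} {Ω U : Set (EuclideanSpace ℝ (Fin n))} {σ : EuclideanSpace ℝ (Fin n) → ℝ}
  {x : EuclideanSpace ℝ (Fin n)}

lemma IsSmoothlyBounded.isOpen (hΩ : IsSmoothlyBounded Ω) : IsOpen Ω := by
  obtain ⟨r, hr, rfl, -⟩ := hΩ
  exact isOpen_lt hr.continuous continuous_const

lemma IsSmoothLocalDefiningFunction.contDiffAt (hσ : IsSmoothLocalDefiningFunction Ω U σ)
    (hU : IsOpen U) (hx : x ∈ U) : ContDiffAt ℝ ∞ σ x :=
  hσ.1.contDiffAt (hU.mem_nhds hx)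

lemma IsSmoothLocalDefiningFunction.mem_iff (hσ : IsSmoothLocalDefiningFunction Ω U σ)
    (hx : x ∈ U) : x ∈ Ω ↔ σ x < 0 := by
  have := Set.ext_iff.1 hσ.2 x
  simpa [hx] using this

lemma IsSmoothLocalDefiningFunction.eq_zero_of_mem_frontier
    (hσ : IsSmoothLocalDefiningFunction Ω U σ) (hΩ : IsOpen Ω) (hU : IsOpen U)
    (hx : x ∈ frontier Ω) (hxU : x ∈ U) : σ x = 0 := by
  rw [hΩ.frontier_eq] at hx
  refine le_antisymm ?_ (not_lt.1 fun h => hx.2 ((hσ.mem_iff hxU).2 h))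
  by_contra! h
  have hc : ∀ᶠ z in 𝓝 x, 0 < σ z ∧ z ∈ U :=
    ((hσ.contDiffAt hU hxU).continuousAt.eventually_const_lt h).and (hU.mem_nhds hxU)
  obtain ⟨z, hzΩ, hz, hzU⟩ := ((mem_closure_iff_frequently.1 hx.1).and_eventually hc).exists
  exact lt_asymm hz ((hσ.mem_iff hzU).1 hzΩ)

/-- Moving from `x` in a direction of decrease enters `Ω` at once. Without a nonzero derivative, a
zero of `σ` could be interior to the complement. -/
lemma IsSmoothLocalDefiningFunction.mem_frontier_of_eq_zero
    (hσ : IsSmoothLocalDefiningFunction Ω U σ) (hΩ : IsOpen Ω) (hU : IsOpen U)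
    (hxU : x ∈ U) (hx : σ x = 0) (hd : fderiv ℝ σ x ≠ 0) : x ∈ frontier Ω := by
  rw [hΩ.frontier_eq]
  refine ⟨?_, fun h => ((hσ.mem_iff hxU).1 h).ne hx⟩
  obtain ⟨v, hv⟩ : ∃ v, fderiv ℝ σ x v < 0 := by
    by_contra! h
    refine hd (ContinuousLinearMap.ext fun v => le_antisymm ?_ (h v))
    simpa using h (-v)
  have hs := eventually_neg_of_fderiv_neg
    ((hσ.contDiffAt hU hxU).differentiableAt (by simp)) hx hv
  have ht : Tendsto (fun s : ℝ => x + s • v) (𝓝[>] 0) (𝓝 x) := by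
    refine Tendsto.mono_left ?_ nhdsWithin_le_nhds
    have : Continuous fun s : ℝ => x + s • v := by fun_prop
    simpa using this.tendsto 0
  refine mem_closure_of_tendsto ht ?_
  filter_upwards [hs, ht (hU.mem_nhds hxU)] with s h1 h2 using (hσ.mem_iff h2).2 h1

/-- Convexity may be tested with any local defining function. -/
lemma IsConvexDomainOn.fderiv_fderiv_nonneg (hconv : IsConvexDomainOn Ω U)
    (hσ : IsSmoothLocalDefiningFunction Ω U σ) (hΩ : IsOpen Ω) (hU : IsOpen U)
    (hx : x ∈ frontier Ω) (hxU : x ∈ U) (hd : fderiv ℝ σ x ≠ 0) {ξ : EuclideanSpace ℝ (Fin n)}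
    (hξ : fderiv ℝ σ x ξ = 0) : 0 ≤ fderiv ℝ (fderiv ℝ σ) x ξ ξ := by
  obtain ⟨r, hr, hr0, hrc⟩ := hconv
  have hσx := hσ.contDiffAt hU hxU
  have hrx := hr.contDiffAt hU hxU
  obtain ⟨v, hv⟩ : ∃ v, fderiv ℝ σ x v = 1 := by
    obtain ⟨w, hw⟩ : ∃ w, fderiv ℝ σ x w ≠ 0 := by
      by_contra! h
      exact hd (ContinuousLinearMap.ext h)
    exact ⟨(fderiv ℝ σ x w)⁻¹ • w, by simp [hw]⟩
  have hz : ∀ᶠ z in 𝓝 x, σ z = 0 → r z = 0 := by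
    have hc : ContinuousAt (fderiv ℝ σ) x := hσx.continuousAt_fderiv (by simp)
    filter_upwards [hU.mem_nhds hxU, hc.eventually_ne hd] with z hzU hzd hz
    exact hr.eq_zero_of_mem_frontier hΩ hU (hσ.mem_frontier_of_eq_zero hΩ hU hzU hz hzd) hzU
  have hσ2 : ContDiffAt ℝ 2 σ x := hσx.of_le (mod_cast ENat.LEInfty.out)
  have hr2 : ContDiffAt ℝ 2 r x := hrx.of_le (mod_cast ENat.LEInfty.out)
  have hσ1 := hσ.eq_zero_of_mem_frontier hΩ hU hx hxU
  obtain ⟨h1, h2⟩ := exists_multiplier_of_eventually_eq_zero hσ2 hr2 hσ1 hv hz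
  have hne : fderiv ℝ r x v ≠ 0 := by
    intro h
    rw [h, zero_smul] at h1
    refine hr0 x ⟨hx, hxU⟩ ?_
    rw [gradient, h1, map_zero]
  -- With a negative multiplier, a small step along `-v` would make `σ` negative and `r` positive,
  -- though both define `Ω`.
  have hpos : 0 < fderiv ℝ r x v := by
    refine lt_of_le_of_ne (not_lt.1 fun h => ?_) hne.symm
    have e1 := eventually_neg_of_fderiv_neg (hσ2.differentiableAt two_ne_zero) hσ1
      (v := -v) (by simp [hv])
    have e2 := eventually_neg_of_fderiv_neg (f := fun z => - r z) (y := x) (v := -v)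
      (hr2.differentiableAt two_ne_zero).neg
      (by simp [hr.eq_zero_of_mem_frontier hΩ hU hx hxU]) (by simpa [fderiv_fun_neg] using h)
    have ht : Tendsto (fun s : ℝ => x + s • -v) (𝓝[>] 0) (𝓝 x) := by
      refine Tendsto.mono_left ?_ nhdsWithin_le_nhds
      have : Continuous fun s : ℝ => x + s • -v := by fun_prop
      simpa using this.tendsto 0
    obtain ⟨s, h3, h4, h5⟩ := (e1.and (e2.and (ht (hU.mem_nhds hxU)))).exists
    have := (hr.mem_iff h5).1 ((hσ.mem_iff h5).2 h3)
    linarith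
  have h3 := hrc x ⟨hx, hxU⟩ ξ (by rw [inner_gradient_eq_fderiv, h1]; simp [hξ])
  rw [realHessian, h2 ξ hξ] at h3
  exact nonneg_of_mul_nonneg_right h3 hpos

end Domain

/-! ### Nearest points and the quadratic form estimate. -/

section Estimate

lemma norm_taylor_one_le_of_lipschitzOnWith {E F : Type*} [NormedAddCommGroup E] [NormedSpace ℝ E]
    [NormedAddCommGroup F] [NormedSpace ℝ F] {f : E → F} {s : Set E} (hs : Convex ℝ s) {K : ℝ}
    (hf : ∀ z ∈ s, DifferentiableAt ℝ f z)
    (hK : ∀ z ∈ s, ∀ w ∈ s, ‖fderiv ℝ f z - fderiv ℝ f w‖ ≤ K * ‖z - w‖) (hK0 : 0 ≤ K) {x y : E}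
    (hx : x ∈ s) (hy : y ∈ s) :
    ‖f x - f y - fderiv ℝ f y (x - y)‖ ≤ K * ‖x - y‖ ^ 2 := by
  have hsub : segment ℝ y x ⊆ s := hs.segment_subset hy hx
  refine (Convex.norm_image_sub_le_of_norm_fderiv_le' (C := K * ‖x - y‖)
    (fun z hz => hf z (hsub hz)) (fun z hz => ?_) (convex_segment y x) (left_mem_segment ℝ y x)
    (right_mem_segment ℝ y x)).trans_eq (by ring)
  refine (hK z (hsub hz) y hy).trans ?_
  gcongr
  exact norm_sub_le_of_mem_segment hz

variable {E : Type*} [NormedAddCommGroup E] [InnerProductSpace ℝ E]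

/-- The displacement from a point to a nearest point of a regular level set is normal to it. -/
lemma sub_eq_smul_gradient_of_nearest [CompleteSpace E] {g : E → ℝ} {x y : E}
    (hg : ContDiffAt ℝ 2 g y) (hgy : g y = 0) (hν : ‖gradient g y‖ = 1)
    (h : ∀ᶠ z in 𝓝 y, g z = 0 → ‖x - y‖ ≤ ‖x - z‖) : ∃ t : ℝ, x - y = t • gradient g y := by
  have hgν : fderiv ℝ g y (gradient g y) = 1 := by
    rw [← inner_gradient_eq_fderiv, real_inner_self_eq_norm_sq, hν, one_pow]
  have key : ∀ ξ, fderiv ℝ g y ξ = 0 → inner ℝ (x - y) ξ = 0 := by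
    intro ξ hξ
    obtain ⟨γ, -, rfl, hγ1, hγg⟩ := exists_curve_of_fderiv_eq_zero hg hgy hgν hξ
    have hd := (hγ1.const_sub x).norm_sq
    have hmin : IsLocalMin (fun s => ‖x - γ s‖ ^ 2) 0 := by
      filter_upwards [hγg, hγ1.continuousAt.eventually h] with s hs hs'
      have := hs' hs
      gcongr
    have := hmin.hasDerivAt_eq_zero hd
    simpa using this
  set t : ℝ := inner ℝ (gradient g y) (x - y) with ht
  refine ⟨t, ?_⟩
  -- The vector `x - y - tν`, with `ν` the gradient at `y`, is tangent, hence orthogonal both to `ν`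
  -- and, by `key`, to `x - y`; so it is orthogonal to itself.
  have h1 : fderiv ℝ g y (x - y - t • gradient g y) = 0 := by
    rw [map_sub, map_smul, hgν, ← inner_gradient_eq_fderiv]
    simp [ht]
  have h2 := key _ h1
  rw [← inner_gradient_eq_fderiv] at h1
  rw [← sub_eq_zero, ← inner_self_eq_zero (𝕜 := ℝ)]
  nth_rw 1 [inner_sub_left]
  rw [h2, real_inner_smul_left, h1]
  simp

/-- A symmetric form that is nonnegative on the orthogonal complement of `ν` satisfies
`‖Aτ‖² ≤ ‖A‖ ⟨Aτ, τ⟩` there. -/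
lemma norm_sq_le_of_nonneg {A : E →L[ℝ] E →L[ℝ] ℝ} (hA : ∀ v w, A v w = A w v) {ν τ η : E} {K : ℝ}
    (hK : 0 < K) (hAK : ‖A‖ ≤ K) (hpos : ∀ w, inner ℝ ν w = 0 → 0 ≤ A w w)
    (hτ : inner ℝ ν τ = 0) (hη : ∀ ζ, A τ ζ = inner ℝ η ζ) (hην : inner ℝ ν η = 0) :
    ‖η‖ ^ 2 ≤ K * A τ τ := by
  -- This test vector is tangent because `η` is. Expanding gives `K² A(τ,τ) - 2K‖η‖² + A(η,η) ≥ 0`,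
  -- where `A(η,η) ≤ K‖η‖²`.
  have h1 := hpos (K • τ - η) (by rw [inner_sub_right, real_inner_smul_right, hτ, hην]; simp)
  have h2 : A τ η = ‖η‖ ^ 2 := by rw [hη, real_inner_self_eq_norm_sq]
  have h3 : A η η ≤ K * ‖η‖ ^ 2 := by
    calc A η η ≤ ‖A η η‖ := le_abs_self _
      _ ≤ ‖A‖ * ‖η‖ * ‖η‖ := A.le_opNorm₂ η η
      _ ≤ K * ‖η‖ * ‖η‖ := by gcongr
      _ = K * ‖η‖ ^ 2 := by ring
  simp only [map_sub, map_smul, _root_.sub_apply, _root_.smul_apply, smul_eq_mul, hA η τ, h2] at h1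
  refine le_of_mul_le_mul_left ?_ hK
  nlinarith

/-- Lower bound for the form `B` in terms of a form `A` that is nonnegative on the orthogonal
complement of `ν` and whose variation `D` towards `B` satisfies a Riccati type equation. -/
lemma quadratic_lower_bound {A B D : E →L[ℝ] E →L[ℝ] ℝ} (hA : ∀ v w, A v w = A w v)
    (hB : ∀ v w, B v w = B w v) {ν : E} (hν : ‖ν‖ = 1) {K t : ℝ} (hK : 0 < K)
    (hKt : 2 * K * |t| ≤ 1) (hAK : ‖A‖ ≤ K) (hBK : ‖B‖ ≤ K) (hBA : ‖B - A‖ ≤ K * |t|)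
    (hBD : ‖B - A - t • D‖ ≤ K * t ^ 2) (hpos : ∀ w, inner ℝ ν w = 0 → 0 ≤ A w w)
    (hAν : ∀ w, inner ℝ ν w = 0 → A w ν = 0)
    (hD : ∀ w, inner ℝ ν w = 0 →
      ∃ η, (∀ ζ, A w ζ = inner ℝ η ζ) ∧ D w w = A ν ν * A w w - ‖η‖ ^ 2) (ξ : E) :
    -(2 * K * t ^ 2 * ‖ξ‖ ^ 2) - 2 * K * inner ℝ ν ξ ^ 2 ≤ B ξ ξ := by
  set a : ℝ := inner ℝ ν ξ with ha
  obtain ⟨τ, hτ⟩ : ∃ τ, τ = ξ - a • ν := ⟨_, rfl⟩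
  have hξ : ξ = τ + a • ν := by rw [hτ]; abel
  have hντ : inner ℝ ν τ = 0 := by
    rw [hτ, inner_sub_right, real_inner_smul_right, real_inner_self_eq_norm_sq, hν]
    simp [ha]
  have hnorm : ‖ξ‖ ^ 2 = ‖τ‖ ^ 2 + a ^ 2 := by
    rw [hξ, norm_add_sq_real, real_inner_smul_right, real_inner_comm, hντ, norm_smul, hν]
    simp
  have bound : ∀ (C : E →L[ℝ] E →L[ℝ] ℝ) (c : ℝ), ‖C‖ ≤ c → ∀ v w, |C v w| ≤ c * ‖v‖ * ‖w‖ :=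
    fun C c hC v w => (C.le_opNorm₂ v w).trans (by gcongr)
  obtain ⟨η, hη, hDτ⟩ := hD τ hντ
  have hη2 := norm_sq_le_of_nonneg hA hK hAK hpos hντ hη
    (by rw [real_inner_comm, ← hη, hAν τ hντ])
  have hq := hpos τ hντ
  have b1 := bound _ _ hBD τ τ
  have b2 := bound _ _ hBA τ ν
  have b3 := bound _ _ hBK ν ν
  have b4 := bound _ _ hAK ν ν
  simp only [_root_.sub_apply, _root_.smul_apply, smul_eq_mul, hν, mul_one, hAν τ hντ, sub_zero]
    at b1 b2 b3 b4
  -- the tangential part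
  have hDb : |D τ τ| ≤ 2 * K * A τ τ := by
    have h1 : |A ν ν * A τ τ| ≤ K * A τ τ := by
      rw [abs_mul, abs_of_nonneg hq]
      gcongr
    rw [hDτ, abs_le]
    rw [abs_le] at h1
    constructor <;> nlinarith [sq_nonneg ‖η‖]
  -- The bound on `D` is proportional to `A τ τ`, so `2K|t| ≤ 1` lets `A τ τ` absorb the first-order
  -- term.
  have htD : -(A τ τ) ≤ t * D τ τ := by
    have h1 : |t * D τ τ| ≤ A τ τ := by
      rw [abs_mul]
      calc |t| * |D τ τ| ≤ |t| * (2 * K * A τ τ) := by gcongr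
        _ = (2 * K * |t|) * A τ τ := by ring
        _ ≤ 1 * A τ τ := by gcongr
        _ = A τ τ := one_mul _
    exact (abs_le.1 h1).1
  have hτB : -(K * t ^ 2 * ‖τ‖ ^ 2) ≤ B τ τ := by
    have := (abs_le.1 b1).1
    nlinarith
  -- the mixed part
  have hmix : -(K * (a ^ 2 + t ^ 2 * ‖τ‖ ^ 2)) ≤ 2 * (a * B τ ν) := by
    have h1 : |a * B τ ν| ≤ K * (|a| * (|t| * ‖τ‖)) := by
      rw [abs_mul]
      calc |a| * |B τ ν| ≤ |a| * (K * |t| * ‖τ‖) := by gcongr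
        _ = _ := by ring
    have h2 : 2 * (|a| * (|t| * ‖τ‖)) ≤ a ^ 2 + t ^ 2 * ‖τ‖ ^ 2 := by
      have := two_mul_le_add_sq |a| (|t| * ‖τ‖)
      rw [mul_pow, sq_abs, sq_abs] at this
      linarith
    have h3 := (abs_le.1 h1).1
    nlinarith
  have hνB : -(K * a ^ 2) ≤ a ^ 2 * B ν ν := by
    have := (abs_le.1 b3).1
    nlinarith [sq_nonneg a]
  have hexp : B ξ ξ = B τ τ + 2 * (a * B τ ν) + a ^ 2 * B ν ν := by
    rw [hξ]
    simp only [map_add, map_smul, _root_.add_apply, _root_.smul_apply, smul_eq_mul, hB ν τ]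
    ring
  rw [hexp, hnorm]
  nlinarith [mul_nonneg (mul_nonneg hK.le (sq_nonneg t)) (sq_nonneg a)]

end Estimate

/-! ### Uniform Taylor bounds near a point. -/

/-- Uniform zeroth and first order Taylor estimates near a point. -/
lemma ContDiffAt.exists_taylor_bounds {E F : Type*} [NormedAddCommGroup E] [NormedSpace ℝ E]
    [NormedAddCommGroup F] [NormedSpace ℝ F] {f : E → F} {p : E} (hf : ContDiffAt ℝ 2 f p) :
    ∃ K : ℝ, 0 ≤ K ∧ ∀ᶠ ε in 𝓝[>] (0 : ℝ), ∀ x ∈ Metric.ball p ε, ∀ y ∈ Metric.ball p ε,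
      ‖f x‖ ≤ K ∧ ‖f x - f y‖ ≤ K * ‖x - y‖ ∧
        ‖f x - f y - fderiv ℝ f y (x - y)‖ ≤ K * ‖x - y‖ ^ 2 := by
  have c1 : ContDiffAt ℝ 1 (fderiv ℝ f) p := hf.fderiv_right (by norm_num)
  obtain ⟨K₁, s₁, hs₁, hL₁⟩ := (hf.of_le one_le_two).exists_lipschitzOnWith
  obtain ⟨K₂, s₂, hs₂, hL₂⟩ := c1.exists_lipschitzOnWith
  have ev : ∀ᶠ x in 𝓝 p, x ∈ s₁ ∧ x ∈ s₂ ∧ DifferentiableAt ℝ f x ∧ ‖f x‖ < ‖f p‖ + 1 := by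
    filter_upwards [hs₁, hs₂, hf.eventually (by simp),
      hf.continuousAt.norm.eventually_lt_const (lt_add_one _)] with x h1 h2 h3 h4
      using ⟨h1, h2, h3.differentiableAt two_ne_zero, h4⟩
  obtain ⟨δ, hδ, hb⟩ := Metric.eventually_nhds_iff_ball.1 ev
  have k1 := K₁.coe_nonneg
  have k2 := K₂.coe_nonneg
  have hN := norm_nonneg (f p)
  refine ⟨‖f p‖ + 1 + K₁ + K₂, by positivity, ?_⟩
  filter_upwards [Ioc_mem_nhdsGT hδ] with ε hε x hx y hy
  replace hb := fun x hx => hb x (Metric.ball_subset_ball hε.2 hx)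
  refine ⟨by linarith [(hb x hx).2.2.2], (hL₁.norm_sub_le (hb x hx).1 (hb y hy).1).trans ?_,
    norm_taylor_one_le_of_lipschitzOnWith (convex_ball p ε) (fun z hz => (hb z hz).2.2.1)
      (fun z hz w hw => (hL₂.norm_sub_le (hb z hz).2.1 (hb w hw).2.1).trans ?_)
      (by positivity) hx hy⟩
  all_goals gcongr; linarith

/-- Uniform Taylor estimates for `f` and its first two derivatives near a point. -/
lemma ContDiffAt.exists_taylor_bounds_fderiv_fderiv {E : Type*} [NormedAddCommGroup E]
    [NormedSpace ℝ E] {f : E → ℝ} {p : E} (hf : ContDiffAt ℝ 4 f p) :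
    ∃ K : ℝ, 0 < K ∧ ∀ᶠ ε in 𝓝[>] (0 : ℝ),
      (∀ x ∈ Metric.ball p ε, ‖fderiv ℝ (fderiv ℝ f) x‖ ≤ K) ∧
      ∀ x ∈ Metric.ball p ε, ∀ y ∈ Metric.ball p ε,
        ‖fderiv ℝ f x - fderiv ℝ f y‖ ≤ K * ‖x - y‖ ∧
        ‖fderiv ℝ (fderiv ℝ f) x - fderiv ℝ (fderiv ℝ f) y‖ ≤ K * ‖x - y‖ ∧
        ‖f x - f y - fderiv ℝ f y (x - y)‖ ≤ K * ‖x - y‖ ^ 2 ∧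
        ‖fderiv ℝ (fderiv ℝ f) x - fderiv ℝ (fderiv ℝ f) y
          - fderiv ℝ (fderiv ℝ (fderiv ℝ f)) y (x - y)‖ ≤ K * ‖x - y‖ ^ 2 := by
  have c1 : ContDiffAt ℝ 3 (fderiv ℝ f) p := hf.fderiv_right (by norm_num)
  have c2 : ContDiffAt ℝ 2 (fderiv ℝ (fderiv ℝ f)) p := c1.fderiv_right (by norm_num)
  obtain ⟨K₀, k0, h₀⟩ := (hf.of_le (by norm_num : (2 : WithTop ℕ∞) ≤ 4)).exists_taylor_bounds
  obtain ⟨K₁, k1, h₁⟩ := (c1.of_le (by norm_num : (2 : WithTop ℕ∞) ≤ 3)).exists_taylor_bounds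
  obtain ⟨K₂, k2, h₂⟩ := c2.exists_taylor_bounds
  obtain ⟨K, hK⟩ : ∃ K, K = 1 + K₀ + K₁ + K₂ := ⟨_, rfl⟩
  refine ⟨K, by rw [hK]; positivity, ?_⟩
  filter_upwards [h₀, h₁, h₂] with ε h₀ h₁ h₂
  refine ⟨fun x hx => (h₂ x hx x hx).1.trans (by linarith), fun x hx y hy =>
    ⟨(h₁ x hx y hy).2.1.trans ?_, (h₂ x hx y hy).2.1.trans ?_, (h₀ x hx y hy).2.2.trans ?_,
      (h₂ x hx y hy).2.2.trans ?_⟩⟩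
  all_goals gcongr; linarith

/-! ### The main theorem. -/

theorem propositionP (n : ℕ) (Ω : Set (EuclideanSpace ℝ (Fin n))) (hΩ : IsSmoothlyBounded Ω)
    (p : EuclideanSpace ℝ (Fin n)) (hp : p ∈ frontier Ω)
    (U : Set (EuclideanSpace ℝ (Fin n))) (hU : IsOpen U) (hpU : p ∈ U)
    (σ : EuclideanSpace ℝ (Fin n) → ℝ) (hσ : IsSmoothLocalDefiningFunction Ω U σ)
    (hσ1 : ∀ x ∈ frontier Ω ∩ U, ‖gradient σ x‖ = 1)
    (hconv : IsConvexDomainOn Ω U) :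
    ∃ V : Set (EuclideanSpace ℝ (Fin n)), IsOpen V ∧ p ∈ V ∧ V ⊆ U ∧
      ∃ C₁ C₂ : ℝ, 0 < C₁ ∧ 0 < C₂ ∧
        ∀ x ∈ V, gradient σ x ≠ 0 ∧
          ∀ ξ : EuclideanSpace ℝ (Fin n),
            -C₁ * (σ x) ^ 2 * ‖ξ‖ ^ 2
                - C₂ * (|inner ℝ (gradient σ x) ξ| ^ 2 / ‖gradient σ x‖ ^ 2)
              ≤ realHessian σ ξ ξ x := by
  have hΩo := hΩ.isOpen
  have hsm : ∀ x ∈ U, ContDiffAt ℝ 4 σ x := fun x hx =>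
    (hσ.contDiffAt hU hx).of_le (mod_cast ENat.LEInfty.out)
  obtain ⟨K, hK, hKε⟩ := (hsm p hpU).exists_taylor_bounds_fderiv_fderiv
  have hgc : ContinuousAt (gradient σ) p :=
    (contDiffAt_gradient ((hsm p hpU).of_le (by norm_num))).continuousAt
  have hgp := hσ1 p ⟨hp, hpU⟩
  have ev : ∀ᶠ x in 𝓝 p, x ∈ U ∧ gradient σ x ≠ 0 ∧ ‖gradient σ x‖ < 2 := by
    filter_upwards [hU.mem_nhds hpU,
      hgc.eventually_ne (norm_ne_zero_iff.1 (by rw [hgp]; exact one_ne_zero)),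
      hgc.norm.eventually_lt_const (hgp.trans_lt one_lt_two)] with x h1 h2 h3
      using ⟨h1, h2, h3⟩
  obtain ⟨ε₀, hε₀, hb⟩ := Metric.eventually_nhds_iff_ball.1 ev
  obtain ⟨ε, ⟨hA, hT⟩, hε, hεε₀⟩ := (hKε.and (Ioc_mem_nhdsGT hε₀)).exists
  replace hb := fun x hx => hb x (Metric.ball_subset_ball hεε₀ hx)
  replace hε : 0 < ε := hε
  have hεU : Metric.ball p ε ⊆ U := fun x hx => (hb x hx).1
  have hg0 := fun x hx => (hb x hx).2.1
  have hg2 := fun x hx => (hb x hx).2.2.le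
  have hδ : 0 < min (ε / 2) (1 / (2 * K)) := by positivity
  have hδε : min (ε / 2) (1 / (2 * K)) ≤ ε := (min_le_left _ _).trans (by linarith)
  have hfd : ∀ x ∈ Metric.ball p ε, fderiv ℝ σ x ≠ 0 := fun x hx h =>
    hg0 x hx (by rw [gradient, h, map_zero])
  have hfr : ∀ z ∈ Metric.ball p ε, σ z = 0 → z ∈ frontier Ω := fun z hz hz0 =>
    hσ.mem_frontier_of_eq_zero hΩo hU (hεU hz) hz0 (hfd z hz)
  -- The radius `ε / 2` keeps the nearest boundary point in the `ε`-ball, and `1 / (2 * K)` gives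
  -- `2K|t| ≤ 1`. With `t² ≤ 4σ(x)²`, the coefficient `2K + 4K³` of `t²‖ξ‖²` becomes `8K + 16K³`. In
  -- `16K = 2K·2·4`, the 2 comes from moving the normal component from `y` to `x`, the 4 from
  -- `‖∇σ(x)‖ ≤ 2`.
  refine ⟨Metric.ball p (min (ε / 2) (1 / (2 * K))), Metric.isOpen_ball, Metric.mem_ball_self hδ,
    (Metric.ball_subset_ball hδε).trans hεU, 8 * K + 16 * K ^ 3, 16 * K, by positivity,
    by positivity, fun x hx => ⟨hg0 x (Metric.ball_subset_ball hδε hx), fun ξ => ?_⟩⟩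
  obtain ⟨y, hy, hxy⟩ := isClosed_frontier.exists_infDist_eq_dist ⟨p, hp⟩ x
  have hmin : ∀ z ∈ frontier Ω, ‖x - y‖ ≤ ‖x - z‖ := fun z hz => by
    rw [← dist_eq_norm, ← dist_eq_norm, ← hxy]
    exact Metric.infDist_le_dist_of_mem hz
  have hxδ : ‖x - y‖ < min (ε / 2) (1 / (2 * K)) :=
    (hmin p hp).trans_lt (by simpa [dist_eq_norm] using hx)
  have hxε : x ∈ Metric.ball p ε := Metric.ball_subset_ball hδε hx
  have hyε : y ∈ Metric.ball p ε := by
    have h1 := (lt_min_iff.1 (Metric.mem_ball.1 hx)).1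
    have h2 := (lt_min_iff.1 hxδ).1
    have h3 := dist_triangle_left y p x
    rw [dist_eq_norm x y] at h3
    rw [Metric.mem_ball]
    linarith
  have hyU := hεU hyε
  have hσy := hσ.eq_zero_of_mem_frontier hΩo hU hy hyU
  have hν := hσ1 y ⟨hy, hyU⟩
  have hball : Metric.ball p ε ∈ 𝓝 y := Metric.isOpen_ball.mem_nhds hyε
  obtain ⟨t, ht⟩ := sub_eq_smul_gradient_of_nearest ((hsm y hyU).of_le (by norm_num)) hσy hν
    (by filter_upwards [hball] with z hz hz0 using hmin z (hfr z hz hz0))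
  have htn : ‖x - y‖ = |t| := by rw [ht, norm_smul, hν, mul_one, Real.norm_eq_abs]
  have hKt : 2 * K * |t| ≤ 1 := by
    rw [← htn]
    have := (lt_min_iff.1 hxδ).2.le
    rwa [le_div_iff₀' (by positivity)] at this
  set ν := gradient σ y with hνdef
  have hin : ∀ w, inner ℝ ν w = fderiv ℝ σ y w := inner_gradient_eq_fderiv σ y
  have hsymm : ∀ z ∈ U, ∀ v w, fderiv ℝ (fderiv ℝ σ) z v w = fderiv ℝ (fderiv ℝ σ) z w v :=
    fun z hz v w => ((hsm z hz).isSymmSndFDerivAt (by simp; norm_num)).eq v w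
  have hnorm : ∀ᶠ z in 𝓝 y, σ z = 0 → ‖gradient σ z‖ = 1 := by
    filter_upwards [hball] with z hz hz0 using hσ1 z ⟨hfr z hz hz0, hεU hz⟩
  have hy3 : ContDiffAt ℝ 3 σ y := (hsm y hyU).of_le (by norm_num)
  obtain ⟨LD, LA, T0, T2⟩ := hT x hxε y hyε
  rw [htn] at LD LA
  rw [htn, sq_abs, ht, map_smul] at T2
  rw [htn, sq_abs, ht, map_smul, ← hin, real_inner_self_eq_norm_sq, hν, hσy, sub_zero,
    one_pow, smul_eq_mul, mul_one, Real.norm_eq_abs] at T0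
  have hlow := quadratic_lower_bound (hsymm y hyU) (hsymm x (hεU hxε)) hν hK hKt (hA y hyε)
    (hA x hxε) LA T2
    (fun w hw => hconv.fderiv_fderiv_nonneg hσ hΩo hU hy hyU (hfd y hyε) (by rwa [← hin]))
    (fun w hw => (fderiv_identities_of_norm_gradient_eq_one hy3 hσy hnorm (by rwa [← hin])).1)
    (fun w hw => (fderiv_identities_of_norm_gradient_eq_one hy3 hσy hnorm (by rwa [← hin])).2) ξ
  -- comparison of `t` with `σ x`
  have ht2 : t ^ 2 ≤ 4 * σ x ^ 2 := by
    -- Taylor at `y` gives `|σ x - t| ≤ K t²`, which is at most `|t| / 2`.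
    have h1 : K * t ^ 2 ≤ |t| / 2 := by
      rw [← sq_abs t]
      nlinarith [abs_nonneg t]
    have h2 : |t| ≤ 2 * |σ x| := by
      have := abs_sub_abs_le_abs_sub t (σ x)
      rw [abs_sub_comm] at this
      linarith
    rw [← sq_abs t, ← sq_abs (σ x)]
    nlinarith [abs_nonneg t]
  -- comparison of the normal components at `y` and at `x`
  set b : ℝ := inner ℝ (gradient σ x) ξ with hb
  have hab : inner ℝ ν ξ ^ 2 ≤ 2 * b ^ 2 + 2 * K ^ 2 * t ^ 2 * ‖ξ‖ ^ 2 := by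
    have h1 : |inner ℝ ν ξ - b| ≤ K * |t| * ‖ξ‖ := by
      rw [hin, hb, inner_gradient_eq_fderiv, abs_sub_comm, ← _root_.sub_apply]
      exact ((fderiv ℝ σ x - fderiv ℝ σ y).le_opNorm ξ).trans (by gcongr)
    have h2 : (inner ℝ ν ξ - b) ^ 2 ≤ K ^ 2 * t ^ 2 * ‖ξ‖ ^ 2 := by
      rw [← sq_abs, ← sq_abs t, ← mul_pow, ← mul_pow]
      gcongr
    nlinarith [sq_nonneg (inner ℝ ν ξ - 2 * b)]
  have hbq : b ^ 2 ≤ 4 * (|b| ^ 2 / ‖gradient σ x‖ ^ 2) := by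
    have hpos : 0 < ‖gradient σ x‖ := norm_pos_iff.2 (hg0 x hxε)
    rw [sq_abs, ← mul_div_assoc, le_div_iff₀ (by positivity), mul_comm]
    gcongr
    nlinarith [hg2 x hxε]
  have e1 : 2 * K * inner ℝ ν ξ ^ 2 ≤
      16 * K * (|b| ^ 2 / ‖gradient σ x‖ ^ 2) + 4 * K ^ 3 * (t ^ 2 * ‖ξ‖ ^ 2) := by
    have := mul_le_mul_of_nonneg_left hab (by positivity : 0 ≤ 2 * K)
    have := mul_le_mul_of_nonneg_left hbq (by positivity : 0 ≤ 4 * K)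
    linarith
  have e2 : (2 * K + 4 * K ^ 3) * (t ^ 2 * ‖ξ‖ ^ 2) ≤
      (2 * K + 4 * K ^ 3) * (4 * σ x ^ 2 * ‖ξ‖ ^ 2) := by gcongr
  rw [realHessian]
  linarith
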